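/- Let $K$ be a number field and let $Q_3\subset\mathbb P^4$ be a smooth quadric threefold defined over $K$. Let $D\subset Q_3$ be one of the following closed subsets defined over $K$: (i) a hyperplane section $D=Q_3\cap H_1$; (ii) a union of two hyperplane sections $D=(Q_3\cap H_1)\cup(Q_3\cap H_2)$, with $H_1,H_2$ defined over $K$; (iii) a smooth quadric section $D=Q_3\cap G$, that is, $G\subset\mathbb P^4$ is a quadric hypersurface and the scheme $Q_3\cap G$ is a smooth surface. Then the integral points of $Q_3$ with respect to $D$ are potentially dense: there are a finite extension $L$ of $K$ and a finite set $S$ of places of $L$, containing the archimedean ones, such that the set of $S$-integral points of $Q_3$ with respect to $D$ is Zariski-dense in $Q_3$. Here an $L$-rational point of $Q_3\setminus D$ is called $S$-integral with respect to $D$ if for no place $v\notin S$ of $L$ it reduces to $D$ modulo $v$, i.e. its reduction modulo $v$ does not lie on the reduction of the Zariski closure of $D$ in $\mathbb P^4$ over the local ring at $v$. -/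

import Mathlib

open MvPolynomial NumberField IsDedekindDomain
open scoped LinearAlgebra.Projectivization

universe u

/-- The polynomial `f` vanishes at the point `P` of projective `n`-space over `Ω`: it is zero at
every vector of homogeneous coordinates of `P`. -/
def VanishesAt {F Ω : Type u} [Field F] [Field Ω] [Algebra F Ω] {n : ℕ}
    (f : MvPolynomial (Fin (n + 1)) F) (P : ℙ Ω (Fin (n + 1) → Ω)) : Prop :=
  ∀ (x : Fin (n + 1) → Ω) (hx : x ≠ 0), Projectivization.mk Ω x hx = P → aeval x f = 0

/-- The closed algebraic subset of projective `n`-space over `Ω` cut out by a set of polynomials. -/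
def projZeros (Ω : Type u) {F : Type u} [Field F] [Field Ω] [Algebra F Ω] {n : ℕ}
    (T : Set (MvPolynomial (Fin (n + 1)) F)) : Set (ℙ Ω (Fin (n + 1) → Ω)) :=
  {P | ∀ f ∈ T, VanishesAt f P}

/-- The Zariski closure of a set of points of projective `n`-space over `Ω`. -/
def zariskiClosure {Ω : Type u} [Field Ω] {n : ℕ} (A : Set (ℙ Ω (Fin (n + 1) → Ω))) :
    Set (ℙ Ω (Fin (n + 1) → Ω)) :=
  {P | ∀ (d : ℕ) (f : MvPolynomial (Fin (n + 1)) Ω), f.IsHomogeneous d →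
    (∀ R ∈ A, VanishesAt f R) → VanishesAt f P}

/-- Jacobian criterion: the common zero scheme in projective `n`-space of the forms `F 0, …,
F (m - 1)` over `K` is smooth of codimension `m`, that is, at each of its geometric points the
gradients of the forms are linearly independent. -/
def IsSmoothCompleteIntersection {K : Type u} [Field K] {n m : ℕ}
    (F : Fin m → MvPolynomial (Fin (n + 1)) K) : Prop :=
  ∀ x : Fin (n + 1) → AlgebraicClosure K, x ≠ 0 → (∀ j, aeval x (F j) = 0) →
    LinearIndependent (AlgebraicClosure K) (fun j i => aeval x (pderiv i (F j)))

/-- Homogeneous coordinates that are primitive at the finite place `v`: all of them are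
`v`-integral and one of them is a `v`-unit. -/
def IsPrimitiveAt {L : Type u} [Field L] [NumberField L] (v : HeightOneSpectrum (𝓞 L)) {n : ℕ}
    (x : Fin (n + 1) → L) : Prop :=
  (∀ i, v.valuation L (x i) ≤ 1) ∧ ∃ i, v.valuation L (x i) = 1

/-- The vector `x`, seen in `Ω`, as a point of projective `n`-space over `Ω`. -/
def geomPoint (Ω : Type u) {L : Type u} [Field L] [Field Ω] [Algebra L Ω] {n : ℕ}
    (x : Fin (n + 1) → L) (hx : x ≠ 0) : ℙ Ω (Fin (n + 1) → Ω) :=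
  Projectivization.mk Ω (fun i => algebraMap L Ω (x i)) (fun h => hx (funext fun i =>
    (algebraMap L Ω).injective ((congrFun h i).trans (map_zero (algebraMap L Ω)).symm)))

/-- The `L`-rational point `P` reduces to the closed set `D` modulo `v`. The reduction of `D` is the
special fibre at `v` of its Zariski closure over the local ring of `v`; it is cut out by the
reductions of the forms with `v`-integral coefficients that vanish on `D`. -/
def ReducesTo {L Ω : Type u} [Field L] [NumberField L] [Field Ω] [Algebra L Ω]
    (v : HeightOneSpectrum (𝓞 L)) {n : ℕ}
    (D : Set (ℙ Ω (Fin (n + 1) → Ω))) (P : ℙ L (Fin (n + 1) → L)) : Prop :=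
  ∀ (x : Fin (n + 1) → L) (hx : x ≠ 0), Projectivization.mk L x hx = P → IsPrimitiveAt v x →
    ∀ (d : ℕ) (f : MvPolynomial (Fin (n + 1)) L), f.IsHomogeneous d →
      (∀ m, v.valuation L (f.coeff m) ≤ 1) → (∀ R ∈ D, VanishesAt f R) →
        v.valuation L (eval x f) < 1

/-- The `S`-integral points of `X` with respect to `D` (as geometric points), where `S` consists of
the archimedean places of `L` and the given finite ones: the `L`-rational points of `X` outside `D`
that do not reduce to `D` modulo any place outside `S`. -/
def integralPoints {L Ω : Type u} [Field L] [NumberField L] [Field Ω] [Algebra L Ω]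
    (S : Finset (HeightOneSpectrum (𝓞 L))) {n : ℕ} (X D : Set (ℙ Ω (Fin (n + 1) → Ω))) :
    Set (ℙ Ω (Fin (n + 1) → Ω)) :=
  {P | P ∈ X \ D ∧ ∃ (x : Fin (n + 1) → L) (hx : x ≠ 0), geomPoint Ω x hx = P ∧
    ∀ v ∉ S, ¬ ReducesTo v D (Projectivization.mk L x hx)}

/-- The integral points of `X` with respect to `D` are potentially dense: for some finite extension
`L` of `K` and some finite set `S` of places of `L`, the `S`-integral points are Zariski-dense
in `X`. (A subextension `L` of the algebraic closure of `K` is a number field if and only if it is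
finite over `K`.) -/
def PotentiallyDense (K : Type u) [Field K] [NumberField K] {n : ℕ}
    (X D : Set (ℙ (AlgebraicClosure K) (Fin (n + 1) → AlgebraicClosure K))) : Prop :=
  ∃ (L : IntermediateField K (AlgebraicClosure K)) (_ : NumberField L)
    (S : Finset (HeightOneSpectrum (𝓞 L))), X ⊆ zariskiClosure (integralPoints S X D)

/-!
Write the quadric as `B(x, x) = 0` and the boundary `D` as contained in `G(x, x) = 0`, where `G` is
the product of two linear forms for hyperplane sections. After enlarging the ring `R` of integers,
the vectors `x` with coordinates in `R`, `B(x, x) = 0` and `G(x, x)` a unit of `R` represent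
integral points (`geomPoint_mem_integralPoints`), so it suffices that they are Zariski-dense in the
cone over the quadric.

Let `⟨e, u⟩` be a line on `D`. The endomorphism `N x = B(x, u) e - B(x, e) u` is skew with `N² = 0`,
so `x ↦ x + t (N x)` preserves the quadric; it moves `x` along the other line in which the plane
through `x` and `⟨e, u⟩` meets the quadric. As one intersection of this line with `D` is its point
`t = ∞` on `⟨e, u⟩`, the values of `G` on it are linear in `t`: `G(x, x)` is multiplied by
`1 + t c`. As `2` may be assumed to be a unit, `1 + t c` is a power of `2` for infinitely many `t`
in `R`, and for these the flow takes the integral vector `x` to integral vectors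
(`infinite_flow_mem_integralVectors`). Consequently the derivation given by `N` preserves the ideal
of the integral vectors. The endomorphisms with this property form a linear space, so it contains
the span of all `e ∧ u` for the lines `⟨e, u⟩` on `D`; finitely many lines suffice for this, and a
number field over which they are defined is chosen accordingly.

If this span contains the bivectors of all lines of the quadric in one hyperplane, the flows of the
corresponding `N` connect the points of the quadric (`isotropic_mem_of_flow`) and density follows
(`potentiallyDense_of_wedge_mem_span`). For hyperplane sections this holds because every line in the
section lies on `D`. For a smooth quadric section the pencil is diagonalized to `∑ xᵢ²` and
`∑ aᵢ xᵢ²` (`exists_orthonormal_eigenbasis`), and the sixteen lines on `D` are explicit enough to see that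
their bivectors span everything (`wedge_mem_span_commonLineWedges`).
-/

/-! ### Symmetric bilinear forms -/

section BilinearForms

variable {k V : Type*} [Field k] [AddCommGroup V] [Module k V]

/-- The skew endomorphism `x ↦ B(x, u) e - B(x, e) u` attached to the bivector `e ∧ u`. If `e` and
`u` span a totally isotropic plane, its square is zero and `x ↦ x + t • wedge B e u x` is an
isometry, which moves an isotropic `x` along the line of the quadric that joins it to that plane. -/
def wedge (B : V →ₗ[k] V →ₗ[k] k) : V →ₗ[k] V →ₗ[k] V →ₗ[k] V :=
  LinearMap.mk₂ k (fun e u => (B.flip u).smulRight e - (B.flip e).smulRight u)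
    (fun _ _ _ => by ext; simp [add_smul]; abel)
    (fun c e u => by ext x; simp [mul_smul, smul_sub, smul_comm (B x u) c e])
    (fun _ _ _ => by ext; simp [add_smul]; abel)
    (fun c e u => by ext x; simp [mul_smul, smul_sub, smul_comm (B x e) c u])

@[simp] lemma wedge_apply (B : V →ₗ[k] V →ₗ[k] k) (e u x : V) :
    wedge B e u x = B x u • e - B x e • u := rfl

lemma wedge_self (B : V →ₗ[k] V →ₗ[k] k) (e : V) : wedge B e e = 0 := by
  ext; simp

variable {B : V →ₗ[k] V →ₗ[k] k} (hs : ∀ x y, B x y = B y x)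
  (hn : ∀ x, (∀ y, B x y = 0) → x = 0)

include hn in
lemma bijective_of_nondegenerate [FiniteDimensional k V] : Function.Bijective B := by
  have hinj : Function.Injective B := by
    rw [← LinearMap.ker_eq_bot, LinearMap.ker_eq_bot']
    intro x hx
    exact hn x fun y => by rw [hx]; rfl
  exact ⟨hinj, (LinearMap.injective_iff_surjective_of_finrank_eq_finrank
    (Subspace.dual_finrank_eq (K := k) (V := V)).symm).1 hinj⟩

include hs hn in
lemma exists_orthogonal_of_notMem_span [FiniteDimensional k V] {a b z : V}
    (hz : z ∉ Submodule.span k {a, b}) : ∃ w, B a w = 0 ∧ B b w = 0 ∧ B z w ≠ 0 := by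
  obtain ⟨f, hf, hle⟩ := Submodule.exists_le_ker_of_notMem hz
  obtain ⟨w, rfl⟩ := (bijective_of_nondegenerate hn).2 f
  refine ⟨w, ?_, ?_, ?_⟩
  · rw [hs]; exact hle (Submodule.subset_span (by simp))
  · rw [hs]; exact hle (Submodule.subset_span (by simp))
  · rwa [hs]

lemma exists_orthogonal_notMem_span_singleton [FiniteDimensional k V]
    (hdim : Module.finrank k V = 5) (B : V →ₗ[k] V →ₗ[k] k) (a b c p : V) :
    ∃ z ∉ Submodule.span k {p}, B a z = 0 ∧ B b z = 0 ∧ B c z = 0 := by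
  let F : V →ₗ[k] k × k × k := (B a).prod ((B b).prod (B c))
  have h1 := F.finrank_range_add_finrank_ker
  have h2 : Module.finrank k (LinearMap.range F) ≤ 3 :=
    (Submodule.finrank_le _).trans (by simp)
  have h3 : ¬ LinearMap.ker F ≤ Submodule.span k {p} := fun hle => by
    have := Submodule.finrank_mono hle
    have h4 : Module.finrank k (Submodule.span k {p}) ≤ 1 := by
      simpa using finrank_span_le_card (R := k) ({p} : Set V)
    omega
  obtain ⟨z, hz, hzp⟩ := SetLike.not_le_iff_exists.1 h3
  have hz' : (B a z, B b z, B c z) = 0 := hz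
  simp only [Prod.mk_eq_zero] at hz'
  exact ⟨z, hzp, hz'.1, hz'.2.1, hz'.2.2⟩

/-- A quadratic polynomial `α + 2 β t + γ t²` over an algebraically closed field has a root unless
it is a nonzero constant. -/
lemma exists_quadratic_root [IsAlgClosed k] [CharZero k] (α β γ : k) (h : β ≠ 0 ∨ γ ≠ 0) :
    ∃ t, α + 2 * β * t + γ * t ^ 2 = 0 := by
  by_cases hγ : γ = 0
  · have hβ : β ≠ 0 := by tauto
    exact ⟨-α / (2 * β), by subst hγ; field_simp; ring⟩
  · obtain ⟨s, hs⟩ := IsAlgClosed.exists_pow_nat_eq (β ^ 2 - α * γ) (n := 2) (by norm_num)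
    exact ⟨(s - β) / γ, by field_simp; linear_combination hs⟩

include hs in
lemma apply_add_smul_self (x z : V) (t : k) :
    B (x + t • z) (x + t • z) = B x x + 2 * B x z * t + B z z * t ^ 2 := by
  simp only [map_add, map_smul, LinearMap.add_apply, LinearMap.smul_apply, smul_eq_mul, hs z x]
  ring

include hs hn in
/-- An isotropic vector of `⟨a, b⟩ᗮ` off the hyperplane `mᗮ`. It is found on a line `x + t z`, where
`z` lies in `⟨a, b, m⟩ᗮ`, along which the form is not constant. -/
lemma exists_isotropic [FiniteDimensional k V] [IsAlgClosed k] [CharZero k] {a b m z : V}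
    (hm : m ∉ Submodule.span k {a, b}) (hz : z ∉ Submodule.span k {a, b})
    (ha : B a z = 0) (hb : B b z = 0) (hmz : B m z = 0) :
    ∃ x, B x x = 0 ∧ B a x = 0 ∧ B b x = 0 ∧ B m x ≠ 0 := by
  obtain ⟨x, hax, hbx, hmx⟩ := exists_orthogonal_of_notMem_span hs hn hm
  obtain ⟨y, hay, hby, hzy⟩ := exists_orthogonal_of_notMem_span hs hn hz
  -- `x` may be modified by `y` so that it pairs nontrivially with both `m` and `z`
  obtain ⟨w, haw, hbw, hmw, hzw⟩ : ∃ w, B a w = 0 ∧ B b w = 0 ∧ B m w ≠ 0 ∧ B z w ≠ 0 := by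
    by_cases hzx : B z x = 0
    · by_cases hmy : B m y = 0
      · exact ⟨x + y, by simp [*], by simp [*], by simp [*], by simp [*]⟩
      · exact ⟨y, hay, hby, hmy, hzy⟩
    · exact ⟨x, hax, hbx, hmx, hzx⟩
  obtain ⟨t, ht⟩ := exists_quadratic_root (B w w) (B w z) (B z z) (Or.inl (by rwa [hs]))
  exact ⟨w + t • z, by rw [apply_add_smul_self hs, ht], by simp [*], by simp [*], by simp [*]⟩

include hs hn in
/-- A nondegenerate quadric of dimension three is not contained in two hyperplanes. -/
lemma exists_isotropic_of_two_hyperplanes [FiniteDimensional k V] [IsAlgClosed k] [CharZero k]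
    (hdim : Module.finrank k V = 5) {a b : V} (ha : a ≠ 0) (hb : b ≠ 0) :
    ∃ x, B x x = 0 ∧ B a x ≠ 0 ∧ B b x ≠ 0 := by
  have hker : ∀ c : V, c ≠ 0 → LinearMap.ker (B c) ≠ ⊤ := fun c hc h =>
    hc (hn c fun y => by rw [LinearMap.ker_eq_top.1 h]; rfl)
  have hspan : Submodule.span k {a, b} ≠ ⊤ := fun h => by
    obtain ⟨z, hz, haz, hbz, -⟩ := exists_orthogonal_notMem_span_singleton hdim B a b b 0
    refine hz ?_
    rw [hn z fun y => ?_]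
    · exact Submodule.zero_mem _
    · obtain ⟨α, β, rfl⟩ := Submodule.mem_span_pair.1 (h ▸ Submodule.mem_top : y ∈ _)
      simp [hs z, haz, hbz]
  obtain ⟨p, hpa, hpb, hp⟩ : ∃ p, B a p ≠ 0 ∧ B b p ≠ 0 ∧ p ∉ Submodule.span k {a, b} := by
    by_contra! hcon
    have := Subspace.exists_eq_top_of_iUnion_eq_univ (k := k) (E := V)
      (p := ![LinearMap.ker (B a), LinearMap.ker (B b), Submodule.span k {a, b}]) (by
        refine Set.eq_univ_of_forall fun x => Set.mem_iUnion.2 ?_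
        by_cases h1 : B a x = 0
        · exact ⟨0, h1⟩
        by_cases h2 : B b x = 0
        · exact ⟨1, h2⟩
        exact ⟨2, hcon x h1 h2⟩)
    obtain ⟨i, hi⟩ := this
    fin_cases i
    · exact hker a ha hi
    · exact hker b hb hi
    · exact hspan hi
  obtain ⟨z, haz, hbz, hpz⟩ := exists_orthogonal_of_notMem_span hs hn hp
  obtain ⟨t, ht⟩ := exists_quadratic_root (B p p) (B p z) (B z z) (Or.inl hpz)
  exact ⟨p + t • z, by rw [apply_add_smul_self hs, ht], by simp [*], by simp [*]⟩

end BilinearForms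

/-! ### Connectedness of the isotropic cone -/

section Cone

variable {k V : Type*} [Field k] [IsAlgClosed k] [CharZero k] [AddCommGroup V] [Module k V]
  [FiniteDimensional k V] {B : V →ₗ[k] V →ₗ[k] k}

/-- Let `Z` be a closed cone, stable under the flows attached to the totally isotropic planes in the
hyperplane `nᗮ`. If it contains a point off this hyperplane, it contains every line of the quadric
through this point: such a line meets `nᗮ` in an isotropic vector `w`, and the flow of a suitable
plane through `w` moves along it. -/
lemma mem_of_orthogonal_of_flow (hdim : Module.finrank k V = 5) (hs : ∀ x y, B x y = B y x)
    (hn : ∀ x, (∀ y, B x y = 0) → x = 0) {Z : Set V}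
    (hsmul : ∀ x ∈ Z, ∀ c : k, c • x ∈ Z)
    (hclosed : ∀ x y, (∀ t : k, t ≠ 0 → x + t • y ∈ Z) → x ∈ Z) {n : V}
    (hflow : ∀ e u, B e e = 0 → B u u = 0 → B e u = 0 → B n e = 0 → B n u = 0 →
      ∀ x ∈ Z, ∀ t : k, x + t • wedge B e u x ∈ Z)
    {x y : V} (hx : x ∈ Z) (hxx : B x x = 0) (hyy : B y y = 0) (hnx : B n x ≠ 0)
    (hxy : B x y = 0) : y ∈ Z := by
  obtain ⟨c, w, rfl, hnw⟩ : ∃ c w, y = c • x + w ∧ B n w = 0 := by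
    refine ⟨B n y / B n x, y - (B n y / B n x) • x, by abel, ?_⟩
    simp; field_simp; ring
  have hxw : B x w = 0 := by simpa [hxx] using hxy
  have hww : B w w = 0 := by simpa [hxx, hxw, hs w x] using hyy
  by_cases hw : w = 0
  · simpa [hw] using hsmul x hx c
  have hmem : ∀ z, B z x = 0 → z ∈ Submodule.span k {n, w} → z ∈ Submodule.span k {w} := by
    intro z hzx hz
    obtain ⟨α, β, rfl⟩ := Submodule.mem_span_pair.1 hz
    have : α = 0 := by simpa [hs w x, hxw, hnx] using hzx
    subst this
    simpa using Submodule.smul_mem _ β (Submodule.mem_span_singleton_self w)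
  obtain ⟨z, hzw, hnz, hwz, hxz⟩ := exists_orthogonal_notMem_span_singleton hdim B n w x w
  obtain ⟨u, huu, hnu, hwu, hxu⟩ := exists_isotropic hs hn (a := n) (b := w) (m := x) (z := z)
    (fun h => by
      obtain ⟨β, rfl⟩ := Submodule.mem_span_singleton.1 (hmem x hxx h)
      simp [hnw] at hnx)
    (fun h => hzw (hmem z (by rwa [hs]) h)) hnz hwz hxz
  have key : ∀ t : k, x + t • w ∈ Z := fun t => by
    have := hflow w u hww huu hwu hnw hnu x hx (t / B x u)
    rwa [wedge_apply, hxw, zero_smul, sub_zero, smul_smul, div_mul_cancel₀ _ hxu] at this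
  have key' : ∀ t : k, t ≠ 0 → t • x + w ∈ Z := fun t ht => by
    have := hsmul _ (key t⁻¹) t
    rwa [smul_add, smul_smul, mul_inv_cancel₀ ht, one_smul] at this
  by_cases hc : c = 0
  · subst hc
    rw [zero_smul, zero_add]
    exact hclosed w x fun t ht => by rw [add_comm]; exact key' t ht
  · exact key' c hc

/-- Under the same hypotheses, `Z` contains the whole quadric: any two points of the quadric are
joined by a chain of lines on it whose vertices lie off `nᗮ`, up to the points of the plane
`⟨n, x⟩`, which are limits of other points. -/
lemma isotropic_mem_of_flow (hdim : Module.finrank k V = 5) (hs : ∀ x y, B x y = B y x)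
    (hn : ∀ x, (∀ y, B x y = 0) → x = 0) {Z : Set V}
    (hsmul : ∀ x ∈ Z, ∀ c : k, c • x ∈ Z)
    (hclosed : ∀ x y, (∀ t : k, t ≠ 0 → x + t • y ∈ Z) → x ∈ Z) {n : V}
    (hflow : ∀ e u, B e e = 0 → B u u = 0 → B e u = 0 → B n e = 0 → B n u = 0 →
      ∀ x ∈ Z, ∀ t : k, x + t • wedge B e u x ∈ Z)
    {x : V} (hx : x ∈ Z) (hxx : B x x = 0) (hnx : B n x ≠ 0) {y : V} (hyy : B y y = 0) :
    y ∈ Z := by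
  have step : ∀ {x y : V}, x ∈ Z → B x x = 0 → B y y = 0 → B n x ≠ 0 → B x y = 0 → y ∈ Z :=
    fun hx hxx hyy hnx hxy =>
      mem_of_orthogonal_of_flow hdim hs hn hsmul hclosed hflow hx hxx hyy hnx hxy
  have generic : ∀ y, B y y = 0 → y ∉ Submodule.span k {n, x} → y ∈ Z := by
    intro y hyy hy
    by_cases hxy : B x y = 0
    · exact step hx hxx hyy hnx hxy
    obtain ⟨z, hz0, hxz, hyz, hnz⟩ := exists_orthogonal_notMem_span_singleton hdim B x y n 0
    obtain ⟨v, hvv, hxv, hyv, hnv⟩ := exists_isotropic hs hn (a := x) (b := y) (m := n) (z := z)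
      (fun h => by
        obtain ⟨α, β, hαβ⟩ := Submodule.mem_span_pair.1 h
        by_cases hβ : β = 0
        · rw [← hαβ] at hnx
          simp [hβ, hxx] at hnx
        · refine hy (Submodule.mem_span_pair.2 ⟨β⁻¹, -(β⁻¹ * α), ?_⟩)
          rw [← hαβ, smul_add, smul_smul, smul_smul, inv_mul_cancel₀ hβ]
          module)
      (fun h => by
        obtain ⟨α, β, rfl⟩ := Submodule.mem_span_pair.1 h
        have hα : α = 0 := by simpa [hyy, hs y x, hxy] using hyz
        have hβ : β = 0 := by simpa [hxx, hxy] using hxz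
        simp [hα, hβ] at hz0)
      hxz hyz hnz
    exact step (step hx hxx hvv hnx hxv) hvv hyy hnv (by rwa [hs])
  by_cases hy : y ∈ Submodule.span k {n, x}
  · by_cases hy0 : y = 0
    · simpa [hy0] using hsmul x hx 0
    -- approach `y` along a line of the quadric that is not contained in the plane
    obtain ⟨m, hmy, hnm, hxm, -⟩ := exists_orthogonal_notMem_span_singleton hdim B n x x y
    obtain ⟨p, hpy, hyp, hmp, -⟩ := exists_orthogonal_notMem_span_singleton hdim B y m m y
    obtain ⟨z, hzz, hyz, -, hmz⟩ := exists_isotropic hs hn (a := y) (b := y) (m := m) (z := p)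
      (by simpa using hmy) (by simpa using hpy) hyp hyp hmp
    refine hclosed y z fun t ht => generic _ ?_ ?_
    · rw [apply_add_smul_self hs, hyy, hyz, hzz]; ring
    · intro h
      have h2 : t • z ∈ Submodule.span k {n, x} := by simpa using Submodule.sub_mem _ h hy
      obtain ⟨α, β, hαβ⟩ := Submodule.mem_span_pair.1 h2
      have h3 : B m (t • z) = 0 := by rw [← hαβ]; simp [hs m n, hs m x, hnm, hxm]
      simp [ht, hmz] at h3
  · exact generic y hyy hy

end Cone

/-! ### Linear vector fields and their flows -/

section Flows

variable {k ι : Type*} [Field k]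

/-- The Zariski closure in affine space of a set of points. -/
def affineClosure (A : Set (ι → k)) : Set (ι → k) :=
  {x | ∀ f : MvPolynomial ι k, (∀ a ∈ A, eval a f = 0) → eval x f = 0}

/-- The restriction of a polynomial to the line `t ↦ x + t w`. -/
noncomputable def restrictLine (x w : ι → k) : MvPolynomial ι k →ₐ[k] Polynomial k :=
  aeval fun i => Polynomial.C (x i) + Polynomial.X * Polynomial.C (w i)

lemma eval_restrictLine (x w : ι → k) (f : MvPolynomial ι k) (t : k) :
    (restrictLine x w f).eval t = eval (x + t • w) f := by
  induction f using MvPolynomial.induction_on with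
  | C a => simp [restrictLine]
  | add p q hp hq => simp [hp, hq]
  | mul_X p i hp =>
    rw [map_mul, Polynomial.eval_mul, hp, map_mul]
    simp [restrictLine, -Polynomial.X_mul_C]

lemma derivative_restrictLine [Fintype ι] (x w : ι → k) (f : MvPolynomial ι k) :
    (restrictLine x w f).derivative =
      ∑ i, Polynomial.C (w i) * restrictLine x w (pderiv i f) := by
  classical
  induction f using MvPolynomial.induction_on with
  | C a => simp [restrictLine]
  | add p q hp hq => simp [hp, hq, mul_add, Finset.sum_add_distrib]
  | mul_X p j hp =>
    simp only [map_mul, Polynomial.derivative_mul, hp, Derivation.leibniz, pderiv_X, smul_eq_mul,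
      map_add, mul_add, Finset.sum_add_distrib, Finset.sum_mul]
    rw [add_comm]
    congr 1
    · rw [Finset.sum_eq_single j (fun i _ hi => by simp [Pi.single_eq_of_ne' hi]) (by simp)]
      simp [restrictLine]; ring
    · exact Finset.sum_congr rfl fun i _ => by ring

lemma eval_derivative_restrictLine [Fintype ι] (x w : ι → k) (f : MvPolynomial ι k) (t : k) :
    (restrictLine x w f).derivative.eval t = ∑ i, w i * eval (x + t • w) (pderiv i f) := by
  simp [derivative_restrictLine, Polynomial.eval_finsetSum, eval_restrictLine]

/-- The linear vector fields `x ↦ N x` tangent to the Zariski closure of `A`, in the sense that the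
corresponding derivation preserves the ideal of `A`. -/
def tangentFields [Fintype ι] (A : Set (ι → k)) : Submodule k ((ι → k) →ₗ[k] ι → k) where
  carrier := {N | ∀ f : MvPolynomial ι k, (∀ a ∈ A, eval a f = 0) →
    ∀ a ∈ A, ∑ i, N a i * eval a (pderiv i f) = 0}
  zero_mem' := by simp
  add_mem' := fun {M N} hM hN f hf a ha => by
    simp [add_mul, Finset.sum_add_distrib, hM f hf a ha, hN f hf a ha]
  smul_mem' := fun c N hN f hf a ha => by
    simp [mul_assoc, ← Finset.mul_sum, hN f hf a ha]

/-- The derivation of the polynomial ring given by the linear vector field `x ↦ N x`. -/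
noncomputable def linearVectorField [Fintype ι] [DecidableEq ι] (N : (ι → k) →ₗ[k] ι → k)
    (f : MvPolynomial ι k) : MvPolynomial ι k :=
  ∑ i, (∑ j, C (N (Pi.single j 1) i) * X j) * pderiv i f

lemma eval_linearVectorField [Fintype ι] [DecidableEq ι] (N : (ι → k) →ₗ[k] ι → k)
    (f : MvPolynomial ι k) (x : ι → k) :
    eval x (linearVectorField N f) = ∑ i, N x i * eval x (pderiv i f) := by
  simp only [linearVectorField, map_sum, map_mul, eval_C, eval_X]
  refine Finset.sum_congr rfl fun i _ => ?_
  rw [LinearMap.pi_apply_eq_sum_univ N x]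
  congr 1
  simp only [Finset.sum_apply, Pi.smul_apply, smul_eq_mul, mul_comm]
  refine Finset.sum_congr rfl fun j _ => ?_
  congr 1
  refine congrArg (fun z => N z i) (funext fun l => ?_)
  simp [Pi.single_apply, eq_comm]

/-- If a polynomial vanishing on `A` vanishes at infinitely many points of each line `a + t (N a)`
with `a` in `A`, its derivative along `N` vanishes on `A`. -/
lemma mem_tangentFields_of_infinite [Fintype ι] {A : Set (ι → k)} {N : (ι → k) →ₗ[k] ι → k}
    (h : ∀ a ∈ A, {t : k | a + t • N a ∈ A}.Infinite) : N ∈ tangentFields A := by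
  intro f hf a ha
  have h0 : restrictLine a (N a) f = 0 :=
    Polynomial.eq_zero_of_infinite_isRoot _ <| (h a ha).mono fun t ht => by
      change (restrictLine a (N a) f).eval t = 0
      rw [eval_restrictLine]
      exact hf _ ht
  have h1 := eval_derivative_restrictLine a (N a) f 0
  simpa [h0] using h1.symm

/-- The flow of a tangent vector field with `N (N x) = 0` is `x ↦ x + t (N x)`. It preserves the
closure since all derivatives along it of a polynomial vanishing on `A` vanish on `A`, and the
characteristic is zero. -/
lemma add_smul_mem_affineClosure [Fintype ι] [CharZero k] {A : Set (ι → k)}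
    {N : (ι → k) →ₗ[k] ι → k} (hN : N ∈ tangentFields A) {x : ι → k} (hx : x ∈ affineClosure A)
    (hNx : N (N x) = 0) (t : k) :
    x + t • N x ∈ affineClosure A := by
  classical
  have key : ∀ n : ℕ, ∀ f : MvPolynomial ι k, (∀ a ∈ A, eval a f = 0) →
      (restrictLine x (N x) f).natDegree ≤ n → restrictLine x (N x) f = 0 := by
    intro n
    induction n with
    | zero =>
      intro f hf hdeg
      have h0 := hx f hf
      rw [Polynomial.eq_C_of_natDegree_le_zero hdeg] at *
      have h1 := eval_restrictLine x (N x) f 0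
      rw [zero_smul, add_zero, h0, ← Polynomial.coeff_zero_eq_eval_zero] at h1
      rw [h1, map_zero]
    | succ n ih =>
      intro f hf hdeg
      have hder : (restrictLine x (N x) f).derivative =
          restrictLine x (N x) (linearVectorField N f) := by
        refine Polynomial.funext fun s => ?_
        rw [eval_derivative_restrictLine, eval_restrictLine, eval_linearVectorField]
        simp [hNx]
      have h0 : (restrictLine x (N x) f).derivative = 0 := by
        rw [hder]
        refine ih _ (fun a ha => ?_) ?_
        · rw [eval_linearVectorField]; exact hN f hf a ha
        · rw [← hder]
          exact (Polynomial.natDegree_derivative_le _).trans (by omega)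
      have h1 := Polynomial.derivative_eq_zero.1 h0
      rw [Polynomial.eq_C_of_natDegree_eq_zero h1]
      have h2 := eval_restrictLine x (N x) f 0
      rw [zero_smul, add_zero, hx f hf, ← Polynomial.coeff_zero_eq_eval_zero] at h2
      rw [h2, map_zero]
  intro f hf
  rw [← eval_restrictLine, key _ f hf le_rfl, Polynomial.eval_zero]

lemma smul_mem_affineClosure {A : Set (ι → k)} (h : ∀ a ∈ A, {c : k | c • a ∈ A}.Infinite)
    {x : ι → k} (hx : x ∈ affineClosure A) (c : k) : c • x ∈ affineClosure A := by
  have hsc : ∀ (y : ι → k) (f : MvPolynomial ι k),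
      eval y (aeval (fun i => C c * X i) f : MvPolynomial ι k) = eval (c • y) f := by
    intro y f
    induction f using MvPolynomial.induction_on with
    | C a => simp
    | add p q hp hq => rw [map_add, map_add, map_add, hp, hq]
    | mul_X p i hp => rw [map_mul, map_mul, map_mul, hp]; simp
  intro f hf
  rw [← hsc]
  refine hx _ fun a ha => ?_
  rw [hsc]
  have h0 : restrictLine 0 a f = 0 :=
    Polynomial.eq_zero_of_infinite_isRoot _ <| (h a ha).mono fun t ht => by
      change (restrictLine 0 a f).eval t = 0
      rw [eval_restrictLine, zero_add]
      exact hf _ ht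
  simpa [h0] using (eval_restrictLine 0 a f c).symm

lemma mem_affineClosure_of_line [Infinite k] {A : Set (ι → k)} {x y : ι → k}
    (h : ∀ t : k, t ≠ 0 → x + t • y ∈ affineClosure A) : x ∈ affineClosure A := by
  intro f hf
  have h0 : restrictLine x y f = 0 :=
    Polynomial.eq_zero_of_infinite_isRoot _ <|
      (Set.finite_singleton (0 : k)).infinite_compl.mono fun t ht => by
        change (restrictLine x y f).eval t = 0
        rw [eval_restrictLine]
        exact h t ht f hf
  simpa [h0] using (eval_restrictLine x y f 0).symm

end Flows

/-! ### Unit congruences and integral vectors -/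

section IntegralVectors

variable {k ι : Type*} [Field k]

/-- The vectors `x` with coordinates in the ring `R` that lie on the cone `B(x, x) = 0` and for
which `G(x, x)` is a unit of `R`. -/
def integralVectors (R : Subring k) (B G : (ι → k) →ₗ[k] (ι → k) →ₗ[k] k) : Set (ι → k) :=
  {x | (∀ i, x i ∈ R) ∧ B x x = 0 ∧ G x x ≠ 0 ∧ G x x ∈ R ∧ (G x x)⁻¹ ∈ R}

lemma two_pow_mem_and_inv_mem {R : Subring k} (h2 : (2 : k)⁻¹ ∈ R) (m : ℕ) :
    (2 : k) ^ m ∈ R ∧ ((2 : k) ^ m)⁻¹ ∈ R :=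
  ⟨pow_mem (ofNat_mem R 2) m, by rw [← inv_pow]; exact pow_mem h2 m⟩

/-- If `2` is a unit of `R` and `c ∈ R` divides a positive integer, infinitely many powers of `2`
are congruent to `1` modulo `c`, unless `c = 0`. -/
lemma infinite_two_pow_congruence [CharZero k] {R : Subring k} (h2 : (2 : k)⁻¹ ∈ R) {c : k}
    {n : ℕ} (hn : n ≠ 0) (hnc : (n : k) * c⁻¹ ∈ R) :
    {t : k | t ∈ R ∧ ∃ m : ℕ, t * c = 2 ^ m - 1}.Infinite ∨ c = 0 := by
  by_cases hc : c = 0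
  · exact Or.inr hc
  left
  obtain ⟨a, b, hb, rfl⟩ := Nat.exists_eq_two_pow_mul_odd hn
  have hφ : 0 < b.totient := Nat.totient_pos.2 hb.pos
  refine Set.infinite_of_injective_forall_mem
    (f := fun j : ℕ => ((2 : k) ^ (b.totient * j) - 1) * c⁻¹) ?_ fun j => ⟨?_, b.totient * j, ?_⟩
  · intro i j hij
    have h : (2 : k) ^ (b.totient * i) = 2 ^ (b.totient * j) := by
      have := mul_right_cancel₀ (inv_ne_zero hc) hij
      linear_combination this
    have h' : (2 : ℕ) ^ (b.totient * i) = 2 ^ (b.totient * j) := by exact_mod_cast h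
    exact Nat.eq_of_mul_eq_mul_left hφ (Nat.pow_right_injective le_rfl h')
  · have hmod : 2 ^ (b.totient * j) ≡ 1 [MOD b] := by
      have := (Nat.ModEq.pow_totient (Nat.coprime_two_left.2 hb)).pow j
      rwa [one_pow, ← pow_mul] at this
    obtain ⟨d, hd⟩ := (Nat.modEq_iff_dvd' (Nat.one_le_two_pow)).1 hmod.symm
    have hd' : (2 : k) ^ (b.totient * j) - 1 = b * d := by
      have := congrArg (Nat.cast : ℕ → k) hd
      rwa [Nat.cast_sub Nat.one_le_two_pow, Nat.cast_mul, Nat.cast_pow, Nat.cast_one,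
        Nat.cast_ofNat] at this
    have heq : ((2 : k) ^ (b.totient * j) - 1) * c⁻¹ =
        ((2 : k) ^ a)⁻¹ * (((2 ^ a * b : ℕ) : k) * c⁻¹) * d := by
      rw [hd']; push_cast; field_simp
    change ((2 : k) ^ (b.totient * j) - 1) * c⁻¹ ∈ R
    rw [heq]
    exact mul_mem (mul_mem (two_pow_mem_and_inv_mem h2 a).2 hnc) (natCast_mem R d)
  · exact inv_mul_cancel_right₀ hc _

variable {R : Subring k} {B G : (ι → k) →ₗ[k] (ι → k) →ₗ[k] k}

/-- Scaling by a power of `2`, a unit of `R`, preserves integral vectors. -/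
lemma infinite_smul_mem_integralVectors [CharZero k] (h2 : (2 : k)⁻¹ ∈ R) {x : ι → k}
    (hx : x ∈ integralVectors R B G) : {c : k | c • x ∈ integralVectors R B G}.Infinite := by
  refine Set.infinite_of_injective_forall_mem (f := fun j : ℕ => (2 : k) ^ j) ?_ fun j => ?_
  · intro i j hij
    have h' : (2 : ℕ) ^ i = 2 ^ j := by exact_mod_cast (show (2 : k) ^ i = 2 ^ j from hij)
    exact Nat.pow_right_injective le_rfl h'
  · obtain ⟨h, h'⟩ := two_pow_mem_and_inv_mem h2 j
    obtain ⟨hxR, hB, hG, hGR, hGR'⟩ := hx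
    refine ⟨fun i => mul_mem h (hxR i), by simp [hB], by simp [hG], ?_, ?_⟩
    · simpa using mul_mem h (mul_mem h hGR)
    · simpa [mul_inv] using mul_mem (mul_mem hGR' h') h'

/-- If `e` and `u` span a plane on which both forms vanish, the flow `x + t (B(x, u) e - B(x, e) u)`
multiplies `G(x, x)` by `1 + t c` for some `c`. It preserves integral vectors for the infinitely
many `t` in `R` for which this factor is a power of `2`. -/
lemma infinite_flow_mem_integralVectors [Fintype ι] [CharZero k] (h2 : (2 : k)⁻¹ ∈ R)
    (hR : ∀ c ∈ R, ∃ n : ℕ, n ≠ 0 ∧ (n : k) * c⁻¹ ∈ R)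
    (hB : ∀ x y, B x y = B y x) (hG : ∀ x y, G x y = G y x)
    (hBR : ∀ x y, (∀ i, x i ∈ R) → (∀ i, y i ∈ R) → B x y ∈ R)
    (hGR : ∀ x y, (∀ i, x i ∈ R) → (∀ i, y i ∈ R) → G x y ∈ R)
    {e u : ι → k} (he : ∀ i, e i ∈ R) (hu : ∀ i, u i ∈ R)
    (hBe : B e e = 0) (hBu : B u u = 0) (hBeu : B e u = 0)
    (hGe : G e e = 0) (hGu : G u u = 0) (hGeu : G e u = 0)
    {x : ι → k} (hx : x ∈ integralVectors R B G) :
    {t : k | x + t • wedge B e u x ∈ integralVectors R B G}.Infinite := by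
  obtain ⟨hxR, hBx, hGx, hGxR, hGxR'⟩ := hx
  set w := wedge B e u x with hw
  have hwR : ∀ i, w i ∈ R := fun i => by
    simp only [hw, wedge_apply, Pi.sub_apply, Pi.smul_apply, smul_eq_mul]
    exact sub_mem (mul_mem (hBR _ _ hxR hu) (he i)) (mul_mem (hBR _ _ hxR he) (hu i))
  have hBxw : B x w = 0 := by simp [hw]; ring
  have hBww : B w w = 0 := by simp [hw, hB u e, hBe, hBu, hBeu]
  have hGww : G w w = 0 := by simp [hw, hG u e, hGe, hGu, hGeu]
  have hBt : ∀ t : k, B (x + t • w) (x + t • w) = 0 := fun t => by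
    rw [apply_add_smul_self hB, hBx, hBxw, hBww]; ring
  set c := 2 * G x w * (G x x)⁻¹ with hc
  have hGt : ∀ t : k, G (x + t • w) (x + t • w) = (1 + t * c) * G x x := fun t => by
    rw [apply_add_smul_self hG, hGww, hc]; field_simp; ring
  have hcR : c ∈ R := mul_mem (mul_mem (ofNat_mem R 2) (hGR _ _ hxR hwR)) hGxR'
  have hmem : ∀ t ∈ R, (∃ m : ℕ, t * c = 2 ^ m - 1) →
      x + t • w ∈ integralVectors R B G := by
    rintro t ht ⟨m, hm⟩
    obtain ⟨h, h'⟩ := two_pow_mem_and_inv_mem h2 m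
    have hval : G (x + t • w) (x + t • w) = 2 ^ m * G x x := by rw [hGt, hm]; ring
    refine ⟨fun i => add_mem (hxR i) (mul_mem ht (hwR i)), hBt t, ?_, ?_, ?_⟩ <;> rw [hval]
    · exact mul_ne_zero (pow_ne_zero _ two_ne_zero) hGx
    · exact mul_mem h hGxR
    · rw [mul_inv]; exact mul_mem h' hGxR'
  obtain ⟨n, hn, hnc⟩ := hR c hcR
  rcases infinite_two_pow_congruence h2 hn hnc with hinf | hc0
  · exact hinf.mono fun t ht => hmem t ht.1 ht.2
  · refine (Set.infinite_range_of_injective (Nat.cast_injective (R := k))).mono ?_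
    rintro _ ⟨j, rfl⟩
    exact hmem _ (natCast_mem R j) ⟨0, by simp [hc0]⟩

end IntegralVectors

/-! ### Simultaneous diagonalization and lines on the intersection of two quadrics -/

section Pencil

variable {k V : Type*} [Field k] [AddCommGroup V] [Module k V]

/-- The vectors `e` and `u` span a totally isotropic subspace for `B`. -/
def IsIsotropicPair (B : V →ₗ[k] V →ₗ[k] k) (e u : V) : Prop :=
  B e e = 0 ∧ B u u = 0 ∧ B e u = 0

/-- The bivectors `e ∧ u` of the lines `⟨e, u⟩` on the intersection of the quadrics of `B` and `G`,
as skew endomorphisms for `B`. -/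
def commonLineWedges (B G : V →ₗ[k] V →ₗ[k] k) : Set (V →ₗ[k] V) :=
  {N | ∃ e u, IsIsotropicPair B e u ∧ IsIsotropicPair G e u ∧ N = wedge B e u}

lemma wedge_antisymm (B : V →ₗ[k] V →ₗ[k] k) (e u : V) : wedge B u e = -wedge B e u := by
  ext; simp

/-- The alternating sum over the four choices of signs isolates the bivector of `α` and `β`. -/
lemma sum_signs_wedge (B : V →ₗ[k] V →ₗ[k] k) (p p' v w : V) (r s a b : k) :
    (wedge B p p' - wedge B (p + (-1 - 1 : k) • r • v) (p' + (-1 - 1 : k) • (a * r) • v)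
      - wedge B (p + (-1 - 1 : k) • s • w) (p' + (-1 - 1 : k) • (b * s) • w)
      + wedge B (p + (-1 - 1 : k) • r • v + (-1 - 1 : k) • s • w)
        (p' + (-1 - 1 : k) • (a * r) • v + (-1 - 1 : k) • (b * s) • w)) =
      (4 * r * s * (b - a)) • wedge B v w := by
  simp only [map_add, map_smul, LinearMap.add_apply, LinearMap.smul_apply, wedge_antisymm B v w]
  module

lemma sum_pow_mul_inv_prod_sub [CharZero k] {a : Fin 5 → k} (ha : Function.Injective a) {r : ℕ}
    (hr : r < 4) : ∑ i, a i ^ r * (∏ j ∈ Finset.univ.erase i, (a i - a j))⁻¹ = 0 := by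
  have h := Lagrange.coeff_eq_sum (s := Finset.univ) (v := a) (P := Polynomial.X ^ r)
    ha.injOn (by simp; omega)
  simpa [Polynomial.coeff_X_pow, hr.ne', div_eq_mul_inv, eq_comm] using h

variable {B : V →ₗ[k] V →ₗ[k] k}

/-- A self-adjoint operator without isotropic eigenvectors has orthonormal eigenvectors, found one
after the other in the orthogonal complement of the previous ones. -/
lemma exists_orthonormal_eigenvectors [FiniteDimensional k V] [IsAlgClosed k]
    (hs : ∀ x y, B x y = B y x)
    {T : V →ₗ[k] V} (hT : ∀ x y, B (T x) y = B x (T y))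
    (hiso : ∀ x (a : k), x ≠ 0 → T x = a • x → B x x ≠ 0) :
    ∀ m ≤ Module.finrank k V, ∃ (v : Fin m → V) (a : Fin m → k),
      (∀ i j, B (v i) (v j) = if i = j then 1 else 0) ∧ ∀ i, T (v i) = a i • v i := by
  intro m
  induction m with
  | zero => exact fun _ => ⟨Fin.elim0, Fin.elim0, fun i => i.elim0, fun i => i.elim0⟩
  | succ m ih =>
    intro hm
    obtain ⟨v, a, hv, hTv⟩ := ih (by omega)
    let F : V →ₗ[k] Fin m → k := LinearMap.pi fun i => B (v i)
    have hF : LinearMap.ker F ≠ ⊥ := LinearMap.ker_ne_bot_of_finrank_lt (by simpa using hm)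
    have hmem : ∀ x, x ∈ LinearMap.ker F ↔ ∀ i, B (v i) x = 0 := fun x => by
      simp [F, LinearMap.mem_ker, funext_iff]
    have hinv : ∀ x ∈ LinearMap.ker F, T x ∈ LinearMap.ker F := fun x hx => by
      rw [hmem] at hx ⊢
      intro i
      rw [← hT, hTv, map_smul, LinearMap.smul_apply, hx i, smul_zero]
    have : Nontrivial (LinearMap.ker F) := Submodule.nontrivial_iff_ne_bot.2 hF
    obtain ⟨c, hc⟩ := Module.End.exists_eigenvalue (T.restrict hinv)
    obtain ⟨⟨x, hxF⟩, hx⟩ := hc.exists_hasEigenvector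
    have hx0 : x ≠ 0 := fun h => hx.2 (Subtype.ext h)
    have hTx : T x = c • x := congrArg Subtype.val hx.apply_eq_smul
    rw [hmem] at hxF
    obtain ⟨r, hr⟩ := IsAlgClosed.exists_pow_nat_eq (B x x) (n := 2) (by norm_num)
    have hr0 : r ≠ 0 := by
      rintro rfl
      exact hiso x c hx0 hTx (by rw [← hr]; simp)
    refine ⟨Fin.cons (r⁻¹ • x) v, Fin.cons c a, fun i j => ?_, fun i => ?_⟩
    · refine Fin.cases ?_ (fun i => ?_) i <;> refine Fin.cases ?_ (fun j => ?_) j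
      · simp [← hr]; field_simp
      · simp [hs x, hxF, Fin.succ_ne_zero, eq_comm]
      · simp [hxF, Fin.succ_ne_zero]
      · simp [hv]
    · refine Fin.cases ?_ (fun i => ?_) i
      · simp [hTx, smul_comm r⁻¹ c]
      · simp [hTv]

/-- If the intersection of a nondegenerate quadric of dimension three with another quadric is
smooth, the pencil is `∑ xᵢ²`, `∑ aᵢ xᵢ²` in suitable coordinates, with distinct `aᵢ`. -/
lemma exists_orthonormal_eigenbasis [FiniteDimensional k V] [IsAlgClosed k] [CharZero k]
    (hdim : Module.finrank k V = 5) (hs : ∀ x y, B x y = B y x)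
    (hn : ∀ x, (∀ y, B x y = 0) → x = 0) {G : V →ₗ[k] V →ₗ[k] k} (hG : ∀ x y, G x y = G y x)
    (hsm : ∀ x, x ≠ 0 → B x x = 0 → G x x = 0 → ∀ a, ∃ y, G x y ≠ a * B x y) :
    ∃ (v : Fin 5 → V) (a : Fin 5 → k), Function.Injective a ∧
      (∀ i j, B (v i) (v j) = if i = j then 1 else 0) ∧
      ∀ i j, G (v i) (v j) = if i = j then a i else 0 := by
  let E := LinearEquiv.ofBijective B (bijective_of_nondegenerate hn)
  let T : V →ₗ[k] V := E.symm.toLinearMap ∘ₗ G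
  have hBT : ∀ x, B (T x) = G x := fun x => E.apply_symm_apply (G x)
  have hiso : ∀ x (a : k), x ≠ 0 → T x = a • x → B x x ≠ 0 := by
    intro x a hx hTx hxx
    have hGx : G x = a • B x := by rw [← hBT, hTx, map_smul]
    obtain ⟨y, hy⟩ := hsm x hx hxx (by simp [hGx, hxx]) a
    exact hy (by simp [hGx])
  obtain ⟨v, a, hv, hTv⟩ := exists_orthonormal_eigenvectors hs (T := T)
    (fun x y => by rw [hs x, hBT, hBT, hG]) hiso 5 hdim.ge
  have hGv : ∀ i y, G (v i) y = a i * B (v i) y := fun i y => by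
    rw [← hBT, hTv, map_smul, LinearMap.smul_apply, smul_eq_mul]
  refine ⟨v, a, fun i j hij => ?_, hv, fun i j => by rw [hGv, hv]; simp⟩
  -- two eigenvectors with the same eigenvalue span an isotropic one
  by_contra hne
  obtain ⟨r, hr⟩ := IsAlgClosed.exists_pow_nat_eq (-1 : k) (n := 2) (by norm_num)
  refine hiso (v i + r • v j) (a i) (fun h => ?_) ?_ ?_
  · simpa [hv, hne] using congrArg (B (v i)) h
  · rw [map_add, map_smul, hTv, hTv, ← hij, smul_add, smul_comm]
  · rw [apply_add_smul_self hs, hv, hv, hv, hr]; simp [hne]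

/-- The bivectors of the lines on a smooth intersection of two quadrics span all bivectors. In
coordinates in which the quadrics are `∑ xᵢ²` and `∑ aᵢ xᵢ²`, the sixteen lines are spanned by
`(± sᵢ)` and `(± aᵢ sᵢ)` with `sᵢ² = 1 / ∏ (aᵢ - aⱼ)`, for all choices of signs. -/
lemma wedge_mem_span_commonLineWedges [FiniteDimensional k V] [IsAlgClosed k] [CharZero k]
    (hdim : Module.finrank k V = 5) {G : V →ₗ[k] V →ₗ[k] k}
    {v : Fin 5 → V} {a : Fin 5 → k} (ha : Function.Injective a)
    (hv : ∀ i j, B (v i) (v j) = if i = j then 1 else 0)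
    (hGv : ∀ i j, G (v i) (v j) = if i = j then a i else 0) (e u : V) :
    wedge B e u ∈ Submodule.span k (commonLineWedges B G) := by
  have hsum : ∀ p q : Fin 5 → k, B (∑ i, p i • v i) (∑ i, q i • v i) = ∑ i, p i * q i := by
    intro p q; simp [hv, mul_comm]
  have hGsum : ∀ p q : Fin 5 → k,
      G (∑ i, p i • v i) (∑ i, q i • v i) = ∑ i, a i * (p i * q i) := by
    intro p q; simp [hGv, mul_comm, mul_left_comm]
  choose s hs using fun i => IsAlgClosed.exists_pow_nat_eq
    (∏ j ∈ Finset.univ.erase i, (a i - a j))⁻¹ (n := 2) (by norm_num)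
  have hs0 : ∀ i, s i ≠ 0 := fun i h => by
    have h1 := hs i
    rw [h, zero_pow two_ne_zero, eq_comm, inv_eq_zero, Finset.prod_eq_zero_iff] at h1
    obtain ⟨j, hj, hij⟩ := h1
    exact (Finset.mem_erase.1 hj).1 (ha (sub_eq_zero.1 hij)).symm
  have hpow : ∀ r < 4, ∑ i, a i ^ r * s i ^ 2 = 0 := fun r hr => by
    simpa [hs] using sum_pow_mul_inv_prod_sub ha hr
  have hline : ∀ σ : Fin 5 → k, (∀ i, σ i ^ 2 = 1) →
      wedge B (∑ i, (σ i * s i) • v i) (∑ i, (σ i * (a i * s i)) • v i) ∈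
        Submodule.span k (commonLineWedges B G) := by
    intro σ hσ
    have hterm : ∀ (f : Fin 5 → k) r, r < 4 → (∀ i, f i = σ i ^ 2 * (a i ^ r * s i ^ 2)) →
        ∑ i, f i = 0 := fun f r hr hf => by
      rw [← hpow r hr]
      exact Finset.sum_congr rfl fun i _ => by rw [hf, hσ, one_mul]
    refine Submodule.subset_span ⟨_, _, ⟨?_, ?_, ?_⟩, ⟨?_, ?_, ?_⟩, rfl⟩
    · rw [hsum]; exact hterm _ 0 (by norm_num) fun i => by ring
    · rw [hsum]; exact hterm _ 2 (by norm_num) fun i => by ring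
    · rw [hsum]; exact hterm _ 1 (by norm_num) fun i => by ring
    · rw [hGsum]; exact hterm _ 1 (by norm_num) fun i => by ring
    · rw [hGsum]; exact hterm _ 3 (by norm_num) fun i => by ring
    · rw [hGsum]; exact hterm _ 2 (by norm_num) fun i => by ring
  have hbasis : ∀ i j, wedge B (v i) (v j) ∈ Submodule.span k (commonLineWedges B G) := by
    intro i j
    by_cases hij : i = j
    · rw [hij, wedge_self]; exact Submodule.zero_mem _
    -- `δ` and `ε` are the signs of the coordinates `i` and `j`
    have hsigns : ∀ δ ε : k, δ ^ 2 = 1 → ε ^ 2 = 1 →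
        wedge B (∑ l, s l • v l + (δ - 1) • s i • v i + (ε - 1) • s j • v j)
          (∑ l, (a l * s l) • v l + (δ - 1) • (a i * s i) • v i + (ε - 1) • (a j * s j) • v j) ∈
        Submodule.span k (commonLineWedges B G) := by
      intro δ ε hδ hε
      have h := hline
        (fun l => 1 + (if l = i then δ - 1 else 0) + (if l = j then ε - 1 else 0)) (fun l => by
          split_ifs with h1 h2 h2
          · exact absurd (h1.symm.trans h2) hij
          · rw [add_zero, add_sub_cancel, hδ]
          · rw [add_zero, add_sub_cancel, hε]
          · ring)
      simpa [add_mul, add_smul, Finset.sum_add_distrib, ite_mul, ite_smul, mul_smul] using h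
    have h1 := hsigns 1 1 (by norm_num) (by norm_num)
    have h2 := hsigns (-1) 1 (by norm_num) (by norm_num)
    have h3 := hsigns 1 (-1) (by norm_num) (by norm_num)
    have h4 := hsigns (-1) (-1) (by norm_num) (by norm_num)
    rw [sub_self, zero_smul, add_zero, zero_smul, add_zero, zero_smul, add_zero, zero_smul,
      add_zero] at h1
    rw [sub_self, zero_smul, add_zero, zero_smul, add_zero] at h2
    rw [sub_self, zero_smul, add_zero, zero_smul, add_zero] at h3
    have h := Submodule.add_mem _ (Submodule.sub_mem _ (Submodule.sub_mem _ h1 h2) h3) h4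
    rw [sum_signs_wedge] at h
    have hc : 4 * s i * s j * (a j - a i) ≠ 0 :=
      mul_ne_zero (mul_ne_zero (mul_ne_zero (by norm_num) (hs0 i)) (hs0 j))
        (sub_ne_zero.2 fun h => hij (ha h).symm)
    exact (Submodule.smul_mem_iff _ hc).1 h
  have hli : LinearIndependent k v := by
    rw [Fintype.linearIndependent_iff]
    intro g hg i
    simpa [hv] using congrArg (B (v i)) hg
  have htop := hli.span_eq_top_of_card_eq_finrank' (by simp [hdim])
  refine LinearMap.BilinMap.apply_apply_mem_of_mem_span _ (Set.range v) (Set.range v) (wedge B)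
    ?_ e u (htop ▸ Submodule.mem_top) (htop ▸ Submodule.mem_top)
  rintro _ ⟨i, rfl⟩ _ ⟨j, rfl⟩
  exact hbasis i j

end Pencil

/-! ### Bilinear forms of quadratic polynomials -/

section QuadraticPolynomials

variable {K ι : Type*} [Field K]

lemma MvPolynomial.IsHomogeneous.eq_C_coeff_zero {f : MvPolynomial ι K} (hf : f.IsHomogeneous 0) :
    f = C (coeff 0 f) :=
  totalDegree_eq_zero_iff_eq_C.1 (Nat.le_zero.1 hf.totalDegree_le)

/-- The symmetric Gram matrix of a quadratic polynomial. -/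
noncomputable def gram (q : MvPolynomial ι K) : Matrix ι ι K :=
  fun i j => 2⁻¹ * coeff 0 (pderiv i (pderiv j q))

lemma gram_comm (q : MvPolynomial ι K) (i j : ι) : gram q i j = gram q j i := by
  classical
  let D : ι → Derivation K (MvPolynomial ι K) (MvPolynomial ι K) := pderiv
  have h : ⁅D i, D j⁆ = 0 := by
    refine derivation_ext fun l => ?_
    simp [D, Derivation.commutator_apply, pderiv_X, Pi.single_apply, apply_ite]
  have h' := congrArg (coeff 0) (DFunLike.congr_fun h q)
  rw [Derivation.commutator_apply, coeff_sub] at h'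
  rw [gram, gram, sub_eq_zero.1 (h'.trans (by simp))]

variable (F : Type*) [Field F] [Algebra K F] [Fintype ι]

/-- The bilinear form, over an extension `F` of the field of coefficients, of a quadratic
polynomial: half of its polarization. -/
noncomputable def polarForm (q : MvPolynomial ι K) : (ι → F) →ₗ[F] (ι → F) →ₗ[F] F := by
  classical
  exact Matrix.toLinearMap₂' F ((gram q).map (algebraMap K F))

variable {F}

lemma polarForm_apply (q : MvPolynomial ι K) (x y : ι → F) :
    polarForm F q x y = ∑ i, ∑ j, algebraMap K F (gram q i j) * (x i * y j) := by
  classical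
  simp only [polarForm, Matrix.toLinearMap₂'_apply, smul_eq_mul, Matrix.map_apply]
  exact Finset.sum_congr rfl fun i _ => Finset.sum_congr rfl fun j _ => by ring

lemma polarForm_comm (q : MvPolynomial ι K) (x y : ι → F) :
    polarForm F q x y = polarForm F q y x := by
  rw [polarForm_apply, polarForm_apply, Finset.sum_comm]
  exact Finset.sum_congr rfl fun i _ => Finset.sum_congr rfl fun j _ => by
    rw [gram_comm, mul_comm (x j)]

lemma aeval_pderiv_eq_polarForm [CharZero K] [DecidableEq ι] {q : MvPolynomial ι K}
    (hq : q.IsHomogeneous 2) (x : ι → F) (i : ι) :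
    aeval x (pderiv i q) = 2 * polarForm F q x (Pi.single i 1) := by
  have h1 : (pderiv i q).IsHomogeneous 1 := hq.pderiv
  have h2 : ∀ j, pderiv j (pderiv i q) = C (2 * gram q j i) := fun j => by
    have h3 : (pderiv j (pderiv i q)).IsHomogeneous 0 := h1.pderiv
    rw [h3.eq_C_coeff_zero, gram, mul_inv_cancel_left₀ two_ne_zero]
  have h := congrArg (aeval x) h1.sum_X_mul_pderiv
  simp only [h2, map_sum, map_mul, aeval_X, aeval_C, one_smul, map_ofNat] at h
  rw [← h, polarForm_apply, Finset.mul_sum]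
  refine Finset.sum_congr rfl fun j _ => ?_
  simp [Pi.single_apply]
  ring

lemma aeval_eq_polarForm [CharZero K] {q : MvPolynomial ι K} (hq : q.IsHomogeneous 2) (x : ι → F) :
    aeval x q = polarForm F q x x := by
  classical
  have : CharZero F := charZero_of_injective_algebraMap (algebraMap K F).injective
  have h := congrArg (aeval x) hq.sum_X_mul_pderiv
  simp only [map_sum, map_mul, aeval_X, aeval_pderiv_eq_polarForm hq, map_nsmul] at h
  have h2 : polarForm F q x x = ∑ i, x i * polarForm F q x (Pi.single i 1) := by
    simpa [smul_eq_mul] using congrArg (polarForm F q x) (pi_eq_sum_univ' x)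
  refine mul_left_cancel₀ (two_ne_zero (α := F)) ?_
  rw [nsmul_eq_mul, Nat.cast_ofNat] at h
  rw [← h, h2, Finset.mul_sum]
  exact Finset.sum_congr rfl fun i _ => by ring

/-- The values of a linear form over an algebra. -/
lemma exists_linearMap_aeval {l : MvPolynomial ι K} (hl : l.IsHomogeneous 1) :
    ∃ φ : (ι → F) →ₗ[F] F, ∀ x, aeval x l = φ x := by
  have h1 : ∀ i, pderiv i l = C (coeff 0 (pderiv i l)) := fun i =>
    (show (pderiv i l).IsHomogeneous 0 from hl.pderiv).eq_C_coeff_zero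
  refine ⟨∑ i, LinearMap.smulRight (LinearMap.proj i) (algebraMap K F (coeff 0 (pderiv i l))),
    fun x => ?_⟩
  have h := congrArg (aeval x) hl.sum_X_mul_pderiv
  rw [one_smul, map_sum] at h
  rw [← h, LinearMap.sum_apply]
  refine Finset.sum_congr rfl fun i _ => ?_
  rw [h1 i]
  simp

omit [Fintype ι] in
lemma exists_aeval_ne_zero [Infinite F] {f : MvPolynomial ι K} (hf : f ≠ 0) :
    ∃ x : ι → F, aeval x f ≠ 0 := by
  by_contra! h
  refine hf (map_injective _ (algebraMap K F).injective ?_)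
  rw [map_zero]
  refine MvPolynomial.funext fun x => ?_
  rw [eval_map, map_zero, ← aeval_def, h]

end QuadraticPolynomials

section Jacobian

variable {K : Type u} [Field K] [CharZero K] {n : ℕ} {q g : MvPolynomial (Fin (n + 1)) K}

lemma nondegenerate_of_isSmoothCompleteIntersection (hq : q.IsHomogeneous 2)
    (h : IsSmoothCompleteIntersection ![q]) (x : Fin (n + 1) → AlgebraicClosure K)
    (hx : ∀ y, polarForm (AlgebraicClosure K) q x y = 0) : x = 0 := by
  by_contra hx0
  refine (h x hx0 fun j => ?_).ne_zero 0 (funext fun i => ?_)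
  · rw [Subsingleton.elim j 0]
    exact (aeval_eq_polarForm hq x).trans (hx x)
  · exact (aeval_pderiv_eq_polarForm hq x i).trans (by rw [hx, mul_zero]; rfl)

lemma exists_ne_mul_of_isSmoothCompleteIntersection (hq : q.IsHomogeneous 2)
    (hg : g.IsHomogeneous 2) (h : IsSmoothCompleteIntersection ![q, g])
    {x : Fin (n + 1) → AlgebraicClosure K} (hx0 : x ≠ 0)
    (hqx : polarForm (AlgebraicClosure K) q x x = 0)
    (hgx : polarForm (AlgebraicClosure K) g x x = 0) (a : AlgebraicClosure K) :
    ∃ y, polarForm (AlgebraicClosure K) g x y ≠ a * polarForm (AlgebraicClosure K) q x y := by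
  by_contra! hcon
  have hli := h x hx0 (Fin.forall_fin_two.2
    ⟨(aeval_eq_polarForm hq x).trans hqx, (aeval_eq_polarForm hg x).trans hgx⟩)
  have h1 := Fintype.linearIndependent_iff.1 hli ![-a, 1] (funext fun i => by
    simp only [Fin.sum_univ_two, Matrix.cons_val_zero, Matrix.cons_val_one, Pi.add_apply,
      Pi.smul_apply, smul_eq_mul, aeval_pderiv_eq_polarForm hq, aeval_pderiv_eq_polarForm hg,
      hcon, Pi.zero_apply]
    ring) 1
  simp at h1

end Jacobian

/-! ### Rings of integers -/

section Integers

/-- Finitely many algebraic numbers are integral outside a finite set of places of some number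
field. -/
lemma exists_finset_forall_valuation_le_one (K : Type u) [Field K] [NumberField K]
    {E : Set (AlgebraicClosure K)} (hE : E.Finite) :
    ∃ (L : IntermediateField K (AlgebraicClosure K)) (_ : NumberField L)
      (S : Finset (HeightOneSpectrum (𝓞 L))), ∀ a ∈ E, ∃ b : L,
        algebraMap L (AlgebraicClosure K) b = a ∧ ∀ v ∉ S, v.valuation L b ≤ 1 := by
  classical
  have := hE.to_subtype
  let L := IntermediateField.adjoin K E
  have : FiniteDimensional K L := IntermediateField.finiteDimensional_adjoin fun x _ =>
    (Algebra.IsAlgebraic.isAlgebraic (R := K) x).isIntegral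
  have hL : NumberField L := NumberField.of_module_finite K L
  let b : E → L := fun a => ⟨a, IntermediateField.subset_adjoin K E a.2⟩
  have hfin : (⋃ a : E, HeightOneSpectrum.Support (𝓞 L) (b a)).Finite :=
    Set.finite_iUnion fun a => HeightOneSpectrum.Support.finite (𝓞 L) (b a)
  refine ⟨L, hL, hfin.toFinset, fun a ha => ⟨b ⟨a, ha⟩, rfl, fun v hv => ?_⟩⟩
  by_contra hlt
  exact hv (hfin.mem_toFinset.2 (Set.mem_iUnion.2 ⟨⟨a, ha⟩, not_le.1 hlt⟩))

lemma exists_nat_mul_inv_mem_integer {L : Type*} [Field L] [NumberField L]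
    (S : Set (HeightOneSpectrum (𝓞 L))) (b : L) :
    ∃ n : ℕ, n ≠ 0 ∧ (n : L) * b⁻¹ ∈ S.integer L := by
  have halg : IsAlgebraic ℤ b⁻¹ :=
    (IsFractionRing.isAlgebraic_iff ℤ ℚ L).2 (Algebra.IsAlgebraic.isAlgebraic b⁻¹)
  obtain ⟨m, hm, hint⟩ := halg.exists_integral_multiple
  refine ⟨m.natAbs, by simpa using hm, fun v _ => ?_⟩
  have hint' : IsIntegral ℤ ((m.natAbs : L) * b⁻¹) := by
    rcases Int.natAbs_eq m with h | h
    · rw [h] at hint; simpa using hint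
    · rw [h] at hint; simpa using hint.neg
  exact v.valuation_le_one (⟨_, hint'⟩ : 𝓞 L)

end Integers

section Primitive

variable {K L : Type u} [Field K] [Field L] [NumberField L] [Algebra K L] [CharZero K]

/-- Integral coordinates at which an integral quadratic form takes a unit value are primitive. -/
lemma isPrimitiveAt_of_valuation_eq_one {n : ℕ} (v : HeightOneSpectrum (𝓞 L))
    {g : MvPolynomial (Fin (n + 1)) K} (hg : g.IsHomogeneous 2)
    (hgram : ∀ i j, v.valuation L (algebraMap K L (gram g i j)) ≤ 1) {b : Fin (n + 1) → L}
    (hb : ∀ i, v.valuation L (b i) ≤ 1) (h : v.valuation L (aeval b g) = 1) :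
    IsPrimitiveAt v b := by
  refine ⟨hb, ?_⟩
  by_contra! hne
  have hlt : ∀ i, v.valuation L (b i) < 1 := fun i => (hb i).lt_of_ne (hne i)
  refine (ne_of_lt ?_) h
  rw [aeval_eq_polarForm hg, polarForm_apply]
  refine Valuation.map_sum_lt _ one_ne_zero fun i _ =>
    Valuation.map_sum_lt _ one_ne_zero fun j _ => ?_
  rw [map_mul, map_mul]
  exact mul_lt_one_of_nonneg_of_lt_one_right (hgram i j) zero_le
    (mul_lt_one_of_nonneg_of_lt_one_left zero_le (hlt i) (hb j))

end Primitive

/-! ### Potential density -/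

section PotentialDensity

variable {K : Type u} [Field K] [NumberField K]

/-- If the ring `R` of `S`-integers contains the Gram matrix and the coefficients of `g`, the
integral vectors represent integral points. -/
lemma geomPoint_mem_integralPoints {n : ℕ} {L : IntermediateField K (AlgebraicClosure K)}
    [NumberField L] {S : Finset (HeightOneSpectrum (𝓞 L))} {q g : MvPolynomial (Fin (n + 1)) K}
    (hq : q.IsHomogeneous 2) (hg : g.IsHomogeneous 2)
    (hgram : ∀ i j, ∀ v ∉ S, v.valuation L (algebraMap K L (gram g i j)) ≤ 1)
    (hcoeff : ∀ m, ∀ v ∉ S, v.valuation L (algebraMap K L (coeff m g)) ≤ 1)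
    {D : Set (ℙ (AlgebraicClosure K) (Fin (n + 1) → AlgebraicClosure K))}
    (hD : D ⊆ projZeros (AlgebraicClosure K) {g}) {b : Fin (n + 1) → L} (hb0 : b ≠ 0)
    (hb : ∀ i, ∀ v ∉ S, v.valuation L (b i) ≤ 1)
    (hqb : aeval b q = 0) (hgb0 : aeval b g ≠ 0) (hgb : ∀ v ∉ S, v.valuation L (aeval b g) = 1) :
    geomPoint (AlgebraicClosure K) b hb0 ∈
      integralPoints S (projZeros (AlgebraicClosure K) {q}) D := by
  have haeval : ∀ f : MvPolynomial (Fin (n + 1)) K,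
      aeval (fun i => algebraMap L (AlgebraicClosure K) (b i)) f =
        algebraMap L (AlgebraicClosure K) (aeval b f) := fun f =>
    aeval_algebraMap_apply (AlgebraicClosure K) b f
  refine ⟨⟨?_, fun hmem => ?_⟩, b, hb0, rfl, fun v hv hred => ?_⟩
  · rintro f rfl x hx hxb
    obtain ⟨c, rfl⟩ := (Projectivization.mk_eq_mk_iff' _ _ _ _ _).1 hxb
    have h := haeval f
    rw [hqb, map_zero, aeval_eq_polarForm hq] at h
    rw [aeval_eq_polarForm hq, map_smul, map_smul, LinearMap.smul_apply, h, smul_zero, smul_zero]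
  · have h := hD hmem g rfl _ _ rfl
    rw [haeval, map_eq_zero] at h
    exact hgb0 h
  · have h := hred b hb0 rfl
      (isPrimitiveAt_of_valuation_eq_one v hg (fun i j => hgram i j v hv) (fun i => hb i v hv)
        (hgb v hv)) 2 (map (algebraMap K L) g) (hg.map _)
      (fun m => by rw [coeff_map]; exact hcoeff m v hv)
      (fun P hP x hx hxP => by
        rw [aeval_map_algebraMap]
        exact hD hP g rfl x hx hxP)
    rw [eval_map, ← aeval_def, hgb v hv] at h
    exact lt_irrefl _ h

/-- Integral points are potentially dense if the bivectors of the lines on `B = G = 0` span those of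
all lines of the quadric `B = 0` in a hyperplane `nᗮ`, and the quadric has a point `x₀` outside both
the zero set of `G`, which contains `D`, and this hyperplane. -/
theorem potentiallyDense_of_wedge_mem_span {q g : MvPolynomial (Fin 5) K} (hq : q.IsHomogeneous 2)
    (hg : g.IsHomogeneous 2)
    (hn : ∀ x, (∀ y, polarForm (AlgebraicClosure K) q x y = 0) → x = 0)
    {D : Set (ℙ (AlgebraicClosure K) (Fin 5 → AlgebraicClosure K))}
    (hD : D ⊆ projZeros (AlgebraicClosure K) {g}) {n x₀ : Fin 5 → AlgebraicClosure K}
    (hqx₀ : polarForm (AlgebraicClosure K) q x₀ x₀ = 0)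
    (hgx₀ : polarForm (AlgebraicClosure K) g x₀ x₀ ≠ 0)
    (hnx₀ : polarForm (AlgebraicClosure K) q n x₀ ≠ 0)
    (hspan : ∀ e u, IsIsotropicPair (polarForm (AlgebraicClosure K) q) e u →
      polarForm (AlgebraicClosure K) q n e = 0 → polarForm (AlgebraicClosure K) q n u = 0 →
      wedge (polarForm (AlgebraicClosure K) q) e u ∈ Submodule.span (AlgebraicClosure K)
        (commonLineWedges (polarForm (AlgebraicClosure K) q) (polarForm (AlgebraicClosure K) g))) :
    PotentiallyDense K (n := 4) (projZeros (AlgebraicClosure K) {q}) D := by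
  classical
  set B := polarForm (AlgebraicClosure K) q with hBdef
  set G := polarForm (AlgebraicClosure K) g with hGdef
  have hBs : ∀ x y, B x y = B y x := polarForm_comm q
  have hGs : ∀ x y, G x y = G y x := polarForm_comm g
  -- finitely many lines suffice, so that they are defined over a number field
  obtain ⟨T, hT, hTspan, hTli⟩ :=
    exists_linearIndependent (AlgebraicClosure K) (commonLineWedges B G)
  have hTfin : T.Finite := hTli.setFinite
  have hT' : ∀ N ∈ T, ∃ e u, IsIsotropicPair B e u ∧ IsIsotropicPair G e u ∧ N = wedge B e u :=
    fun N hN => hT hN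
  choose! e u he using hT'
  obtain ⟨L, hL, S, hLS⟩ := exists_finset_forall_valuation_le_one K
    (E := Set.range x₀ ∪ (⋃ N ∈ T, Set.range (e N) ∪ Set.range (u N)) ∪
      ((Set.range fun p : Fin 5 × Fin 5 => algebraMap K (AlgebraicClosure K) (gram q p.1 p.2)) ∪
        (Set.range fun p : Fin 5 × Fin 5 => algebraMap K (AlgebraicClosure K) (gram g p.1 p.2))) ∪
      algebraMap K (AlgebraicClosure K) '' (g.coeffs : Set K) ∪ {2⁻¹, G x₀ x₀, (G x₀ x₀)⁻¹})
    (by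
      refine Set.Finite.union (Set.Finite.union (Set.Finite.union (Set.Finite.union
        (Set.finite_range _) ?_) ((Set.finite_range _).union (Set.finite_range _)))
        (g.coeffs.finite_toSet.image _)) (by simp)
      exact hTfin.biUnion fun N _ => (Set.finite_range _).union (Set.finite_range _))
  -- the ring of `S`-integers of `L`, as a subring of the algebraic closure
  let R : Subring (AlgebraicClosure K) :=
    ((S : Set (HeightOneSpectrum (𝓞 L))).integer L).toSubring.map
      (algebraMap L (AlgebraicClosure K))
  have hRmem : ∀ a : AlgebraicClosure K, a ∈ R ↔
      ∃ b : L, (∀ v ∉ S, v.valuation L b ≤ 1) ∧ algebraMap L (AlgebraicClosure K) b = a :=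
    fun a => Iff.rfl
  have hmemR : ∀ b : L, algebraMap L (AlgebraicClosure K) b ∈ R → ∀ v ∉ S, v.valuation L b ≤ 1 := by
    rintro b ⟨b', hb', hbb'⟩
    rwa [← (algebraMap L (AlgebraicClosure K)).injective hbb']
  have hKmemR : ∀ c : K, algebraMap K (AlgebraicClosure K) c ∈ R →
      ∀ v ∉ S, v.valuation L (algebraMap K L c) ≤ 1 :=
    fun c hc => hmemR _ (by rwa [← IsScalarTower.algebraMap_apply])
  replace hLS : ∀ a ∈ _, a ∈ R := fun a ha => by
    obtain ⟨b, hba, hb⟩ := hLS a ha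
    exact (hRmem a).2 ⟨b, hb, hba⟩
  have h2 : (2 : AlgebraicClosure K)⁻¹ ∈ R := hLS _ (by simp)
  have hx₀R : ∀ i, x₀ i ∈ R := fun i => hLS _ (by simp)
  have hgramq : ∀ i j, algebraMap K (AlgebraicClosure K) (gram q i j) ∈ R := fun i j =>
    hLS _ (Or.inl (Or.inl (Or.inr (Or.inl ⟨(i, j), rfl⟩))))
  have hgramg : ∀ i j, algebraMap K (AlgebraicClosure K) (gram g i j) ∈ R := fun i j =>
    hLS _ (Or.inl (Or.inl (Or.inr (Or.inr ⟨(i, j), rfl⟩))))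
  have hcoeff : ∀ m, algebraMap K (AlgebraicClosure K) (coeff m g) ∈ R := fun m => by
    by_cases hm : coeff m g = 0
    · rw [hm, map_zero]; exact zero_mem R
    · exact hLS _ (Or.inl (Or.inr ⟨_, coeff_mem_coeffs m hm, rfl⟩))
  have heR : ∀ N ∈ T, ∀ i, e N i ∈ R := fun N hN i =>
    hLS _ (Or.inl (Or.inl (Or.inl (Or.inr (Set.mem_biUnion hN (Or.inl ⟨i, rfl⟩))))))
  have huR : ∀ N ∈ T, ∀ i, u N i ∈ R := fun N hN i =>
    hLS _ (Or.inl (Or.inl (Or.inl (Or.inr (Set.mem_biUnion hN (Or.inr ⟨i, rfl⟩))))))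
  have hx₀A : x₀ ∈ integralVectors R B G :=
    ⟨hx₀R, hqx₀, hgx₀, hLS _ (by simp), hLS _ (by simp)⟩
  have hR : ∀ c ∈ R, ∃ m : ℕ, m ≠ 0 ∧ (m : AlgebraicClosure K) * c⁻¹ ∈ R := by
    rintro _ ⟨b, -, rfl⟩
    obtain ⟨m, hm, hmb⟩ := exists_nat_mul_inv_mem_integer (S : Set (HeightOneSpectrum (𝓞 L))) b
    exact ⟨m, hm, _, hmb, by simp⟩
  have hpolar : ∀ f : MvPolynomial (Fin 5) K,
      (∀ i j, algebraMap K (AlgebraicClosure K) (gram f i j) ∈ R) →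
      ∀ x y : Fin 5 → AlgebraicClosure K, (∀ i, x i ∈ R) → (∀ i, y i ∈ R) →
        polarForm (AlgebraicClosure K) f x y ∈ R :=
    fun f hf x y hx hy => by
      rw [polarForm_apply]
      exact sum_mem fun i _ => sum_mem fun j _ => mul_mem (hf i j) (mul_mem (hx i) (hy j))
  -- each flow along one of these lines has infinitely many integral times, hence is tangent
  set A := integralVectors R B G
  have htangent : Submodule.span (AlgebraicClosure K) (commonLineWedges B G) ≤ tangentFields A := by
    rw [← hTspan, Submodule.span_le]
    intro N hN
    obtain ⟨⟨hB1, hB2, hB3⟩, ⟨hG1, hG2, hG3⟩, hNw⟩ := he N hN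
    refine mem_tangentFields_of_infinite fun a ha => ?_
    rw [hNw]
    exact infinite_flow_mem_integralVectors h2 hR hBs hGs (hpolar q hgramq) (hpolar g hgramg)
      (heR N hN) (huR N hN) hB1 hB2 hB3 hG1 hG2 hG3 ha
  have hcone : ∀ y, B y y = 0 → y ∈ affineClosure A := fun y hy =>
    isotropic_mem_of_flow (by simp) hBs hn
      (fun x hx c => smul_mem_affineClosure
        (fun a ha => infinite_smul_mem_integralVectors h2 ha) hx c)
      (fun x y h => mem_affineClosure_of_line h)
      (fun e u hee huu heu hne hnu x hx t =>
        add_smul_mem_affineClosure (htangent (hspan e u ⟨hee, huu, heu⟩ hne hnu)) hx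
          (by simp [hBs u e, hee, huu, heu]) t)
      (fun f hf => hf x₀ hx₀A) hqx₀ hnx₀ hy
  -- a form vanishing at the integral points vanishes on `A`, hence on the whole cone
  refine ⟨L, hL, S, fun P hP d f _ hf x hx hxP => ?_⟩
  have hBx : B x x = 0 := by rw [hBdef, ← aeval_eq_polarForm hq]; exact hP q rfl x hx hxP
  refine hcone x hBx f fun a ha => ?_
  obtain ⟨haR, hBa, hGa, hGaR, hGaR'⟩ := ha
  choose b hb hba using haR
  obtain rfl : (fun i => algebraMap L (AlgebraicClosure K) (b i)) = a := funext hba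
  have haeval : ∀ f : MvPolynomial (Fin 5) K,
      aeval (fun i => algebraMap L (AlgebraicClosure K) (b i)) f =
        algebraMap L (AlgebraicClosure K) (aeval b f) := fun f =>
    aeval_algebraMap_apply (AlgebraicClosure K) b f
  have hGb : G (fun i => algebraMap L (AlgebraicClosure K) (b i))
      (fun i => algebraMap L (AlgebraicClosure K) (b i)) =
        algebraMap L (AlgebraicClosure K) (aeval b g) := by
    rw [← haeval, aeval_eq_polarForm hg]
  rw [hGb] at hGa hGaR hGaR'
  rw [← map_inv₀] at hGaR'
  have hqb : aeval b q = 0 := by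
    rw [← map_eq_zero (algebraMap L (AlgebraicClosure K)), ← haeval, aeval_eq_polarForm hq]
    exact hBa
  have hgb0 : aeval b g ≠ 0 := fun h => hGa (by rw [h, map_zero])
  have hb0 : b ≠ 0 := by
    rintro rfl
    exact hgb0 (by rw [aeval_eq_polarForm hg, map_zero])
  refine hf _ (geomPoint_mem_integralPoints hq hg (fun i j => hKmemR _ (hgramg i j))
    (fun m => hKmemR _ (hcoeff m)) hD hb0 hb hqb hgb0 fun v hv => ?_) _ _ rfl
  refine le_antisymm (hmemR _ hGaR v hv) ?_
  have h := hmemR _ hGaR' v hv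
  rwa [map_inv₀, inv_le_one₀ (zero_lt_iff.2 ((Valuation.ne_zero_iff _).2 hgb0))] at h

end PotentialDensity

/-! ### Hyperplane sections and smooth quadric sections -/

section Sections

variable {K : Type u} [Field K] [NumberField K]

/-- For two hyperplane sections the criterion applies to the hyperplane `l₁ = 0`, since every line
in the first section lies on the zero set of `l₁ l₂`. -/
lemma potentiallyDense_of_subset_two_hyperplanes {q : MvPolynomial (Fin 5) K}
    (hq : q.IsHomogeneous 2) (hsmooth : IsSmoothCompleteIntersection (n := 4) ![q])
    {l₁ l₂ : MvPolynomial (Fin 5) K} (hl₁ : l₁.IsHomogeneous 1) (h₁ : l₁ ≠ 0)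
    (hl₂ : l₂.IsHomogeneous 1) (h₂ : l₂ ≠ 0)
    {D : Set (ℙ (AlgebraicClosure K) (Fin 5 → AlgebraicClosure K))}
    (hD : D ⊆ projZeros (AlgebraicClosure K) {l₁ * l₂}) :
    PotentiallyDense K (n := 4) (projZeros (AlgebraicClosure K) {q}) D := by
  have hn := nondegenerate_of_isSmoothCompleteIntersection hq hsmooth
  have hg : (l₁ * l₂).IsHomogeneous 2 := hl₁.mul hl₂
  have hdual : ∀ l : MvPolynomial (Fin 5) K, l.IsHomogeneous 1 → l ≠ 0 →
      ∃ m, m ≠ 0 ∧ ∀ x, aeval x l = polarForm (AlgebraicClosure K) q m x := by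
    intro l hl hl0
    obtain ⟨φ, hφ⟩ := exists_linearMap_aeval (F := AlgebraicClosure K) hl
    obtain ⟨m, rfl⟩ := (bijective_of_nondegenerate hn).2 φ
    obtain ⟨x, hx⟩ := exists_aeval_ne_zero (F := AlgebraicClosure K) hl0
    exact ⟨m, fun hm => hx (by rw [hφ, hm]; simp), hφ⟩
  obtain ⟨m₁, hm₁, hlm₁⟩ := hdual l₁ hl₁ h₁
  obtain ⟨m₂, hm₂, hlm₂⟩ := hdual l₂ hl₂ h₂
  obtain ⟨x₀, hx₀, hx₁, hx₂⟩ :=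
    exists_isotropic_of_two_hyperplanes (polarForm_comm q) hn (by simp) hm₁ hm₂
  have hG : ∀ x, polarForm (AlgebraicClosure K) (l₁ * l₂) x x =
      polarForm (AlgebraicClosure K) q m₁ x * polarForm (AlgebraicClosure K) q m₂ x := fun x => by
    rw [← aeval_eq_polarForm hg, map_mul, hlm₁, hlm₂]
  refine potentiallyDense_of_wedge_mem_span hq hg hn hD hx₀
    (by rw [hG]; exact mul_ne_zero hx₁ hx₂) hx₁ fun e u heu he hu =>
      Submodule.subset_span
        ⟨e, u, heu, ⟨by rw [hG, he, zero_mul], by rw [hG, hu, zero_mul], ?_⟩, rfl⟩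
  have h := apply_add_smul_self (polarForm_comm (F := AlgebraicClosure K) (l₁ * l₂)) e u 1
  rw [hG, hG e, hG u, map_add, map_smul, he, hu] at h
  simpa using h.symm

/-- For a smooth quadric section the criterion applies to any hyperplane, since the bivectors of its
sixteen lines span all bivectors. -/
lemma potentiallyDense_of_smooth_quadric_section {q g : MvPolynomial (Fin 5) K}
    (hq : q.IsHomogeneous 2) (hsmooth : IsSmoothCompleteIntersection (n := 4) ![q])
    (hg : g.IsHomogeneous 2) (hqg : IsSmoothCompleteIntersection (n := 4) ![q, g])
    {D : Set (ℙ (AlgebraicClosure K) (Fin 5 → AlgebraicClosure K))}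
    (hD : D ⊆ projZeros (AlgebraicClosure K) {g}) :
    PotentiallyDense K (n := 4) (projZeros (AlgebraicClosure K) {q}) D := by
  have hn := nondegenerate_of_isSmoothCompleteIntersection hq hsmooth
  have hdim : Module.finrank (AlgebraicClosure K) (Fin 5 → AlgebraicClosure K) = 5 := by simp
  obtain ⟨v, a, ha, hv, hGv⟩ := exists_orthonormal_eigenbasis hdim (polarForm_comm q) hn
    (polarForm_comm g) fun _ hx hqx hgx =>
      exists_ne_mul_of_isSmoothCompleteIntersection hq hg hqg hx hqx hgx
  obtain ⟨r, hr⟩ := IsAlgClosed.exists_pow_nat_eq (-1 : AlgebraicClosure K) (n := 2) (by norm_num)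
  refine potentiallyDense_of_wedge_mem_span hq hg hn hD (n := v 0) (x₀ := v 0 + r • v 1) ?_ ?_ ?_
    fun e u _ _ _ => wedge_mem_span_commonLineWedges hdim ha hv hGv e u
  · rw [apply_add_smul_self (polarForm_comm q), hv, hv, hv, hr]; simp
  · rw [apply_add_smul_self (polarForm_comm g), hGv, hGv, hGv, hr]
    simpa [← sub_eq_add_neg, sub_eq_zero] using ha.ne (show (0 : Fin 5) ≠ 1 by decide)
  · simp [hv]

omit [NumberField K] in
lemma projZeros_subset_projZeros_of_dvd (q : MvPolynomial (Fin 5) K)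
    {l g : MvPolynomial (Fin 5) K} (h : l ∣ g) :
    projZeros (AlgebraicClosure K) {q, l} ⊆ projZeros (AlgebraicClosure K) {g} := by
  rintro P hP f rfl x hx hxP
  exact zero_dvd_iff.1 (hP l (by simp) x hx hxP ▸ map_dvd (aeval x) h)

end Sections

theorem mainTheorem5 (K : Type u) [Field K] [NumberField K]
    (q : MvPolynomial (Fin 5) K) (hq : q.IsHomogeneous 2)
    (hsmooth : IsSmoothCompleteIntersection (n := 4) ![q]) :
    (∀ l : MvPolynomial (Fin 5) K, l.IsHomogeneous 1 → l ≠ 0 →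
      PotentiallyDense K (n := 4) (projZeros (AlgebraicClosure K) {q})
        (projZeros (AlgebraicClosure K) {q, l})) ∧
    (∀ l₁ l₂ : MvPolynomial (Fin 5) K, l₁.IsHomogeneous 1 → l₁ ≠ 0 →
      l₂.IsHomogeneous 1 → l₂ ≠ 0 →
      PotentiallyDense K (n := 4) (projZeros (AlgebraicClosure K) {q})
        (projZeros (AlgebraicClosure K) {q, l₁} ∪ projZeros (AlgebraicClosure K) {q, l₂})) ∧
    (∀ g : MvPolynomial (Fin 5) K, g.IsHomogeneous 2 →
      IsSmoothCompleteIntersection (n := 4) ![q, g] →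
      PotentiallyDense K (n := 4) (projZeros (AlgebraicClosure K) {q})
        (projZeros (AlgebraicClosure K) {q, g})) := by
  refine ⟨fun l hl hl0 => ?_, fun l₁ l₂ hl₁ h₁ hl₂ h₂ => ?_, fun g hg hqg => ?_⟩
  · exact potentiallyDense_of_subset_two_hyperplanes hq hsmooth hl hl0 hl hl0
      (projZeros_subset_projZeros_of_dvd q (dvd_mul_right l l))
  · exact potentiallyDense_of_subset_two_hyperplanes hq hsmooth hl₁ h₁ hl₂ h₂
      (Set.union_subset (projZeros_subset_projZeros_of_dvd q (dvd_mul_right l₁ l₂))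
        (projZeros_subset_projZeros_of_dvd q (dvd_mul_left l₂ l₁)))
  · exact potentiallyDense_of_smooth_quadric_section hq hsmooth hg hqg
      (projZeros_subset_projZeros_of_dvd q dvd_rfl)
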